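/- Let $k\ge 1$ be an integer, let $p\ge 2$ be an even integer, and let $D$ be a finite digraph (no parallel arcs; pairs of opposite arcs are allowed) on $n\ge\max\{p+2,\,2k+2\}$ vertices. Suppose that $D$ is $2k$-edge-connected, i.e. its underlying multigraph (in which a pair of opposite arcs yields two parallel edges) stays connected after the removal of any set of at most $2k-1$ edges. Then $D$ can be made $k$-arc-strong by inversions of size exactly $p$: there is a set $\mathcal X$ of subsets of $V(D)$, each of size exactly $p$, such that successively inverting the members of $\mathcal X$ (in any order) turns $D$ into a $k$-arc-strong digraph. Here inverting $X\subseteq V(D)$ means reversing the direction of every arc with both endvertices in $X$, and a digraph is $k$-arc-strong if the removal of any set of at most $k-1$ of its arcs leaves a strongly connected digraph. -/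

import Mathlib

/-- Any two vertices of the multigraph `G` are joined by a walk. -/
def Graph.IsConnected {α β : Type*} (G : Graph α β) : Prop :=
  ∀ u ∈ G.vertexSet, ∀ v ∈ G.vertexSet, Relation.ReflTransGen G.Adj u v

/-- The multigraph `G` is `k`-edge-connected: deleting any at most `k - 1` of its edges leaves a
connected multigraph. -/
def Graph.IsKEdgeConnected {α β : Type*} (G : Graph α β) (k : ℕ) : Prop :=
  ∀ F : Finset β, (F : Set β) ⊆ G.edgeSet → F.card < k → (G.deleteEdges (F : Set β)).IsConnected

namespace Digraph

/-- The set of arcs of `D`; an arc from `u` to `v` is the ordered pair `(u, v)`. -/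
def arcs {V : Type*} (D : Digraph V) : Set (V × V) := {a | D.Adj a.1 a.2}

/-- The digraph obtained from `D` by deleting the arcs in `F`. -/
def deleteArcs {V : Type*} (D : Digraph V) (F : Set (V × V)) : Digraph V where
  Adj u v := D.Adj u v ∧ (u, v) ∉ F

/-- The underlying multigraph: every arc becomes an edge, so a digon gives two parallel edges. -/
def underlyingGraph {V : Type*} (D : Digraph V) : Graph V (V × V) where
  vertexSet := Set.univ
  edgeSet := D.arcs
  IsLink e x y := e ∈ D.arcs ∧ (e = (x, y) ∨ e = (y, x))
  isLink_symm _ _ := ⟨fun _ _ h => ⟨h.1, h.2.symm⟩⟩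
  eq_or_eq_of_isLink_of_isLink := by
    rintro e x y v w ⟨-, h | h⟩ ⟨-, h' | h'⟩ <;> subst h <;> simp_all
  edge_mem_iff_exists_isLink e :=
    ⟨fun h => ⟨e.1, e.2, h, Or.inl rfl⟩, fun ⟨_, _, h⟩ => h.1⟩
  left_mem_of_isLink _ _ _ _ := Set.mem_univ _

/-- A digraph is `k`-edge-connected if its underlying multigraph is. -/
def IsKEdgeConnected {V : Type*} (D : Digraph V) (k : ℕ) : Prop :=
  D.underlyingGraph.IsKEdgeConnected k

/-- There is a directed walk from every vertex to every other one. -/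
def IsStronglyConnected {V : Type*} (D : Digraph V) : Prop :=
  ∀ u v : V, Relation.ReflTransGen D.Adj u v

/-- `D` is `k`-arc-strong: deleting any at most `k - 1` of its arcs leaves a strongly connected
digraph. -/
def IsKArcStrong {V : Type*} (D : Digraph V) (k : ℕ) : Prop :=
  ∀ F : Finset (V × V), (F : Set (V × V)) ⊆ D.arcs → F.card < k →
    (D.deleteArcs (F : Set (V × V))).IsStronglyConnected

/-- The inversion of `X` in `D`: all arcs with both endvertices in `X` are reversed. -/
def invert {V : Type*} (D : Digraph V) (X : Finset V) : Digraph V where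
  Adj u v := (u ∈ X ∧ v ∈ X ∧ D.Adj v u) ∨ (¬(u ∈ X ∧ v ∈ X) ∧ D.Adj u v)

instance {V : Type*} : RightCommutative (invert (V := V)) where
  right_comm D X Y := by
    ext u v
    simp only [invert]
    tauto

/-- The digraph obtained from `D` by inverting the members of `𝒳` one after another (in any order,
as inversions commute). -/
def invertAll {V : Type*} (D : Digraph V) (𝒳 : Finset (Finset V)) : Digraph V :=
  𝒳.val.foldl invert D

/-- `D` is `(k, p)`-invertible: it can be made `k`-arc-strong by inverting the members of some set
of vertex sets, each of size exactly `p`. -/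
def IsInvertible {V : Type*} (D : Digraph V) (k p : ℕ) : Prop :=
  ∃ 𝒳 : Finset (Finset V), (∀ X ∈ 𝒳, X.card = p) ∧ (D.invertAll 𝒳).IsKArcStrong k

end Digraph

/-! Inverting `X` toggles every edge of the complete graph on `X`, so a family of inversions acts
through the sum modulo 2 of its cliques (`invertAll_eq_reverseEdges`). As `p` is even and `n ≥ p +
2`, the `p`-cliques span all edge sets of even size (`mem_cliqueSpan_of_sum_eq_zero`). It is
therefore enough to find a good set of edges to reverse and to make its size even.

The set comes from the weak orientation theorem `exists_reversal_forall_le_outDegree`, which raises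
the out-degree of every cut to at least `k`. Its reversals are the integral points of a submodular
flow polytope. Reversing "half" of each arc outside digons is feasible, since every cut has `2k`
arcs, and extreme points are integral by Edmonds and Giles.

Parity is repaired on one pair whose orientation is irrelevant. A nonadjacent pair or a digon serves
if there is one. Otherwise `D` is, up to loops, a tournament and every cut has at least `n - 1 ≥ 2k
+ 1` arcs; one arc can be set aside, the rest oriented without it, and its direction is then free.
-/

/-! ### Net inflow and the submodular flow polytope. -/

section SubmodularFlow

variable {V ι : Type*} [Fintype V] [DecidableEq V] [Fintype ι]

/-- The net inflow of `x` into `X`, where the edge `e` goes from `t e` to `h e`. -/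
def netInflow (t h : ι → V) (x : ι → ℝ) (X : Finset V) : ℝ :=
  ∑ e, x e * ((if h e ∈ X then 1 else 0) - (if t e ∈ X then 1 else 0))

omit [Fintype V] in
theorem netInflow_inter_add_union (t h : ι → V) (x : ι → ℝ) (X Y : Finset V) :
    netInflow t h x (X ∩ Y) + netInflow t h x (X ∪ Y) =
      netInflow t h x X + netInflow t h x Y := by
  simp only [netInflow, ← Finset.sum_add_distrib, ← mul_add]
  refine Finset.sum_congr rfl fun e _ => ?_
  congr 1
  simp only [Finset.mem_inter, Finset.mem_union]
  by_cases h1 : h e ∈ X <;> by_cases h2 : h e ∈ Y <;> by_cases h3 : t e ∈ X <;>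
    by_cases h4 : t e ∈ Y <;> simp [h1, h2, h3, h4]

theorem netInflow_univ (t h : ι → V) (x : ι → ℝ) : netInflow t h x Finset.univ = 0 := by
  simp [netInflow]

omit [Fintype V] in
theorem netInflow_empty (t h : ι → V) (x : ι → ℝ) : netInflow t h x ∅ = 0 := by
  simp [netInflow]

omit [Fintype V] in
theorem netInflow_union_of_disjoint (t h : ι → V) (x : ι → ℝ) {X Y : Finset V}
    (hXY : Disjoint X Y) :
    netInflow t h x (X ∪ Y) = netInflow t h x X + netInflow t h x Y := by
  have := netInflow_inter_add_union t h x X Y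
  rwa [Finset.disjoint_iff_inter_eq_empty.mp hXY, netInflow_empty, zero_add] at this

theorem netInflow_compl (t h : ι → V) (x : ι → ℝ) (X : Finset V) :
    netInflow t h x Xᶜ = -netInflow t h x X := by
  have := netInflow_union_of_disjoint t h x (disjoint_compl_right (a := X))
  rw [← Finset.sup_eq_union, sup_compl_eq_top, Finset.top_eq_univ, netInflow_univ] at this
  linarith

omit [Fintype V] in
theorem netInflow_sdiff (t h : ι → V) (x : ι → ℝ) {X Y : Finset V} (hXY : Y ⊆ X) :
    netInflow t h x (X \ Y) = netInflow t h x X - netInflow t h x Y := by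
  have := netInflow_union_of_disjoint t h x (Finset.sdiff_disjoint (s := Y) (t := X))
  rw [Finset.sdiff_union_of_subset hXY] at this
  linarith

omit [Fintype V] in
theorem netInflow_add_smul (t h : ι → V) (x z : ι → ℝ) (ε : ℝ) (X : Finset V) :
    netInflow t h (x + ε • z) X = netInflow t h x X + ε * netInflow t h z X := by
  simp only [netInflow, Finset.mul_sum, ← Finset.sum_add_distrib]
  refine Finset.sum_congr rfl fun e _ => ?_
  simp only [Pi.add_apply, Pi.smul_apply, smul_eq_mul]
  ring

omit [Fintype V] in
theorem continuous_netInflow (t h : ι → V) (X : Finset V) :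
    Continuous fun x => netInflow t h x X := by
  unfold netInflow
  fun_prop

/-- The polytope of submodular flows with bounds `0` and `1`. -/
def submodularFlows (t h : ι → V) (g : Finset V → ℤ) : Set (ι → ℝ) :=
  {x | (∀ e, 0 ≤ x e ∧ x e ≤ 1) ∧
    ∀ X : Finset V, X.Nonempty → X ≠ Finset.univ → (g X : ℝ) ≤ netInflow t h x X}

theorem isCompact_submodularFlows (t h : ι → V) (g : Finset V → ℤ) :
    IsCompact (submodularFlows t h g) := by
  refine IsCompact.of_isClosed_subset (isCompact_Icc (a := (0 : ι → ℝ)) (b := 1)) ?_ ?_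
  · have : submodularFlows t h g = (⋂ e, {x | 0 ≤ x e ∧ x e ≤ 1}) ∩
        ⋂ X : Finset V, {x | X.Nonempty → X ≠ Finset.univ → (g X : ℝ) ≤ netInflow t h x X} := by
      ext x
      simp [submodularFlows]
    rw [this]
    refine IsClosed.inter (isClosed_iInter fun e => ?_) (isClosed_iInter fun X => ?_)
    · exact (isClosed_le continuous_const (continuous_apply e)).inter
        (isClosed_le (continuous_apply e) continuous_const)
    · by_cases hX : X.Nonempty ∧ X ≠ Finset.univ
      · simpa [hX.1, hX.2] using isClosed_le continuous_const (continuous_netInflow t h X)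
      · convert isClosed_univ
        ext x
        simp only [Set.mem_ofPred_eq, Set.mem_univ, iff_true]
        tauto
  · exact fun x hx => ⟨fun e => (hx.1 e).1, fun e => (hx.1 e).2⟩

/-- At an extreme submodular flow there is no direction along which the integral coordinates and
the tight constraints are preserved. -/
theorem eq_zero_of_mem_extremePoints_submodularFlows {t h : ι → V} {g : Finset V → ℤ}
    {x z : ι → ℝ} (hx : x ∈ (submodularFlows t h g).extremePoints ℝ)
    (hz : ∀ e, x e = 0 ∨ x e = 1 → z e = 0)
    (htight : ∀ X : Finset V, X.Nonempty → X ≠ Finset.univ → netInflow t h x X = g X →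
      netInflow t h z X = 0) : z = 0 := by
  -- Fractional coordinates and slack constraints survive small perturbations, while `hz` and
  -- `htight` freeze all the others. So `x` is the midpoint of a segment in the polytope.
  have hev : ∀ᶠ ε : ℝ in nhds 0, x + ε • z ∈ submodularFlows t h g := by
    have hlim : ∀ a b : ℝ, Filter.Tendsto (fun ε : ℝ => a + ε * b) (nhds 0) (nhds a) := by
      intro a b
      have : Continuous fun ε : ℝ => a + ε * b := by fun_prop
      simpa using this.tendsto 0
    have h1 : ∀ᶠ ε : ℝ in nhds 0, ∀ e, 0 ≤ (x + ε • z) e ∧ (x + ε • z) e ≤ 1 := by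
      rw [Filter.eventually_all]
      intro e
      simp only [Pi.add_apply, Pi.smul_apply, smul_eq_mul]
      have hb := hx.1.1 e
      by_cases he : x e = 0 ∨ x e = 1
      · simp [hz e he, hb.1, hb.2]
      · push Not at he
        have l1 : 0 < x e := lt_of_le_of_ne hb.1 (Ne.symm he.1)
        have l2 : x e < 1 := lt_of_le_of_ne hb.2 he.2
        filter_upwards [(hlim (x e) (z e)).eventually (lt_mem_nhds l1),
          (hlim (x e) (z e)).eventually (gt_mem_nhds l2)] with ε e1 e2
        exact ⟨e1.le, e2.le⟩
    have h2 : ∀ᶠ ε : ℝ in nhds 0, ∀ X : Finset V, X.Nonempty → X ≠ Finset.univ →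
        (g X : ℝ) ≤ netInflow t h (x + ε • z) X := by
      rw [Filter.eventually_all]
      intro X
      by_cases hX : X.Nonempty ∧ X ≠ Finset.univ
      · have hb := hx.1.2 X hX.1 hX.2
        simp only [netInflow_add_smul]
        rcases hb.lt_or_eq with hlt | heq
        · filter_upwards [(hlim _ (netInflow t h z X)).eventually (lt_mem_nhds hlt)] with ε e1
          exact fun _ _ => e1.le
        · simp [htight X hX.1 hX.2 heq.symm, heq]
      · exact Filter.Eventually.of_forall fun ε a b => absurd ⟨a, b⟩ hX
    filter_upwards [h1, h2] with ε e1 e2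
    exact ⟨e1, e2⟩
  obtain ⟨δ, hδ, hball⟩ := Metric.eventually_nhds_iff.mp hev
  have hp := hball (y := δ / 2) (by simp [abs_of_pos hδ]; linarith)
  have hm := hball (y := -(δ / 2)) (by simp [abs_of_pos hδ]; linarith)
  have hseg : x ∈ openSegment ℝ (x + (δ / 2) • z) (x + (-(δ / 2)) • z) := by
    refine ⟨1 / 2, 1 / 2, by norm_num, by norm_num, by norm_num, ?_⟩
    ext e
    simp only [Pi.add_apply, Pi.smul_apply, smul_eq_mul]
    ring
  have := hx.2 hp hm hseg
  have h0 : (δ / 2) • z = 0 := by simpa using this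
  exact (smul_eq_zero.mp h0).resolve_left (by linarith)

end SubmodularFlow

/-! ### Laminar families, uncrossing and atoms. -/

section Laminar

variable {V : Type*} [DecidableEq V]

/-- Two sets overlap if they meet and neither contains the other. -/
def Finset.Overlaps (X Y : Finset V) : Prop :=
  (X ∩ Y).Nonempty ∧ (X \ Y).Nonempty ∧ (Y \ X).Nonempty

/-- A family of sets is laminar if no two of its members overlap. -/
def IsLaminar (L : Finset (Finset V)) : Prop := ∀ X ∈ L, ∀ Y ∈ L, ¬X.Overlaps Y

theorem Finset.Overlaps.symm {X Y : Finset V} (h : X.Overlaps Y) : Y.Overlaps X :=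
  ⟨Finset.inter_comm X Y ▸ h.1, h.2.2, h.2.1⟩

theorem not_overlaps_iff {X Y : Finset V} :
    ¬X.Overlaps Y ↔ Disjoint X Y ∨ X ⊆ Y ∨ Y ⊆ X := by
  simp only [Finset.Overlaps, ← Finset.not_disjoint_iff_nonempty_inter, Finset.sdiff_nonempty]
  tauto

/-- Uncrossing `X` with a member `Y` of a laminar family creates no new overlaps with that family.
Together with `not_overlaps_uncrossed`, this makes the number of overlapping members drop strictly.
-/
theorem overlaps_of_overlaps_uncrossed {X Y Z W : Finset V} (hYX : Y.Overlaps X)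
    (hYZ : ¬Z.Overlaps Y) (hW : W = X ∩ Y ∨ W = X ∪ Y ∨ W = X \ Y ∨ W = Y \ X)
    (h : Z.Overlaps W) : Z.Overlaps X := by
  obtain ⟨⟨a, ha⟩, ⟨b, hb⟩, ⟨c, hc⟩⟩ := hYX
  obtain ⟨⟨d, hd⟩, ⟨e, he⟩, ⟨f, hf⟩⟩ := h
  rw [not_overlaps_iff] at hYZ
  simp only [Finset.Overlaps, Finset.Nonempty]
  rcases hYZ with h | h | h
  · have h' : ∀ v ∈ Z, v ∉ Y := fun v hv hv' => Finset.disjoint_left.mp h hv hv'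
    refine ⟨⟨d, ?_⟩, ⟨e, ?_⟩, ?_⟩
    · rcases hW with rfl | rfl | rfl | rfl <;> grind
    · rcases hW with rfl | rfl | rfl | rfl <;> grind
    · exact ⟨a, by grind⟩
  · refine ⟨?_, ?_, ⟨c, by grind⟩⟩
    · rcases hW with rfl | rfl | rfl | rfl
      · exact ⟨d, by grind⟩
      · exact ⟨d, by grind⟩
      · exact ⟨d, by grind⟩
      · exact ⟨e, by grind⟩
    · rcases hW with rfl | rfl | rfl | rfl
      · exact ⟨e, by grind⟩
      · exact ⟨e, by grind⟩
      · exact ⟨e, by grind⟩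
      · exact ⟨d, by grind⟩
  · refine ⟨⟨a, by grind⟩, ⟨b, by grind⟩, ⟨f, ?_⟩⟩
    rcases hW with rfl | rfl | rfl | rfl <;> grind

theorem not_overlaps_uncrossed {X Y W : Finset V}
    (hW : W = X ∩ Y ∨ W = X ∪ Y ∨ W = X \ Y ∨ W = Y \ X) : ¬Y.Overlaps W := by
  rw [not_overlaps_iff]
  rcases hW with rfl | rfl | rfl | rfl
  · exact Or.inr (Or.inr Finset.inter_subset_right)
  · exact Or.inr (Or.inl Finset.subset_union_right)
  · exact Or.inl Finset.disjoint_sdiff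
  · exact Or.inr (Or.inr Finset.sdiff_subset)

theorem exists_maximal_laminar (T : Finset (Finset V)) :
    ∃ L ⊆ T, IsLaminar L ∧ ∀ X ∈ T, (∀ Y ∈ L, ¬Y.Overlaps X) → X ∈ L := by
  classical
  obtain ⟨L, hL, hmax⟩ := Finset.exists_max_image (T.powerset.filter IsLaminar) Finset.card
    ⟨∅, by simp [IsLaminar]⟩
  rw [Finset.mem_filter, Finset.mem_powerset] at hL
  refine ⟨L, hL.1, hL.2, fun X hX hXL => ?_⟩
  by_contra hnot
  have hself : ¬X.Overlaps X := fun h => by simpa using h.2.1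
  have := hmax (insert X L) (by
    rw [Finset.mem_filter, Finset.mem_powerset]
    refine ⟨Finset.insert_subset hX hL.1, ?_⟩
    intro Y hY Z hZ hYZ
    rcases Finset.mem_insert.mp hY with rfl | hY' <;>
      rcases Finset.mem_insert.mp hZ with rfl | hZ'
    · exact hself hYZ
    · exact hXL Z hZ' hYZ.symm
    · exact hXL Y hY' hYZ
    · exact hL.2 Y hY' Z hZ' hYZ)
  rw [Finset.card_insert_of_notMem hnot] at this
  omega

/-- A modular function that vanishes on a maximal laminar subfamily of a family closed under
uncrossing vanishes on the whole family. -/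
theorem eq_zero_of_eq_zero_on_maximal_laminar {T L : Finset (Finset V)} (hLT : L ⊆ T)
    (hL : IsLaminar L) (hmax : ∀ X ∈ T, (∀ Y ∈ L, ¬Y.Overlaps X) → X ∈ L)
    (hT : ∀ X ∈ T, ∀ Y ∈ T, Y.Overlaps X → (X ∩ Y ∈ T ∧ X ∪ Y ∈ T) ∨ (X \ Y ∈ T ∧ Y \ X ∈ T))
    {φ : Finset V → ℝ}
    (hinter : ∀ X Y, φ (X ∩ Y) + φ (X ∪ Y) = φ X + φ Y)
    (hsdiff : ∀ X Y, φ (X \ Y) - φ (Y \ X) = φ X - φ Y)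
    (hφ : ∀ X ∈ L, φ X = 0) : ∀ X ∈ T, φ X = 0 := by
  classical
  -- Induction on the number of members of `L` overlapping `X`; when there are none, maximality puts
  -- `X` in `L`.
  suffices H : ∀ n, ∀ X ∈ T, (L.filter fun Y => Y.Overlaps X).card = n → φ X = 0 from
    fun X hX => H _ X hX rfl
  intro n
  induction n using Nat.strong_induction_on with
  | _ n ih =>
    intro X hX hn
    by_cases hcross : ∃ Y ∈ L, Y.Overlaps X
    · obtain ⟨Y, hY, hYX⟩ := hcross
      have hlt : ∀ W, (W = X ∩ Y ∨ W = X ∪ Y ∨ W = X \ Y ∨ W = Y \ X) → W ∈ T → φ W = 0 := by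
        intro W hW hWT
        refine ih _ ?_ W hWT rfl
        rw [← hn]
        refine Finset.card_lt_card (Finset.ssubset_iff_of_subset ?_ |>.mpr ⟨Y, ?_, ?_⟩)
        · intro Z hZ
          rw [Finset.mem_filter] at hZ ⊢
          exact ⟨hZ.1, overlaps_of_overlaps_uncrossed hYX (hL Z hZ.1 Y hY) hW hZ.2⟩
        · exact Finset.mem_filter.mpr ⟨hY, hYX⟩
        · exact fun h => not_overlaps_uncrossed hW (Finset.mem_filter.mp h).2
      rcases hT X hX Y (hLT hY) hYX with ⟨h1, h2⟩ | ⟨h1, h2⟩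
      · have := hinter X Y
        rw [hlt _ (by tauto) h1, hlt _ (by tauto) h2, hφ Y hY] at this
        linarith
      · have := hsdiff X Y
        rw [hlt _ (by tauto) h1, hlt _ (by tauto) h2, hφ Y hY] at this
        linarith
    · exact hφ X (hmax X hX fun Y hY h => hcross ⟨Y, hY, h⟩)

variable {G : Type*} [AddCommGroup G]

/-- Members are added in order of decreasing size, so laminarity makes each new one either contained
in an earlier one or disjoint from all of them. -/
theorem mem_biUnion_of_laminar {K : AddSubgroup G} {φ : Finset V → G} (hempty : φ ∅ = 0)
    (hunion : ∀ X Y, Disjoint X Y → φ (X ∪ Y) = φ X + φ Y) (F : Finset (Finset V)) :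
    IsLaminar F → (∀ X ∈ F, φ X ∈ K) → φ (F.biUnion id) ∈ K := by
  refine Finset.induction_on_min_value Finset.card F (fun _ _ => by simp [hempty])
    fun M F hM hmin ih => ?_
  intro hF hK
  have ih' := ih (fun X hX Y hY => hF X (Finset.mem_insert_of_mem hX) Y
    (Finset.mem_insert_of_mem hY)) fun X hX => hK X (Finset.mem_insert_of_mem hX)
  rw [Finset.biUnion_insert, id]
  by_cases hsub : ∃ Y ∈ F, M ⊆ Y
  · obtain ⟨Y, hY, hMY⟩ := hsub
    rwa [Finset.union_eq_right.mpr (hMY.trans (Finset.subset_biUnion_of_mem id hY))]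
  · rw [hunion]
    · exact add_mem (hK M (Finset.mem_insert_self _ _)) ih'
    · rw [Finset.disjoint_biUnion_right]
      intro Y hY
      rcases not_overlaps_iff.mp
        (hF M (Finset.mem_insert_self _ _) Y (Finset.mem_insert_of_mem hY)) with h | h | h
      · exact h
      · exact absurd ⟨Y, hY, h⟩ hsub
      · exact absurd ⟨Y, hY, (Finset.eq_of_subset_of_card_le h (hmin Y hY)).superset⟩ hsub

variable [Fintype V]

/-- If an additive set function takes values in a subgroup on a laminar family and on the ground
set, it does so on each atom of the family. -/
theorem mem_atom_of_laminar {K : AddSubgroup G} {φ : Finset V → G} (hempty : φ ∅ = 0)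
    (hunion : ∀ X Y, Disjoint X Y → φ (X ∪ Y) = φ X + φ Y) (huniv : φ Finset.univ ∈ K)
    {L : Finset (Finset V)} (hL : IsLaminar L) (hK : ∀ X ∈ L, φ X ∈ K) (v : V) :
    φ (Finset.univ.filter fun u => ∀ X ∈ L, u ∈ X ↔ v ∈ X) ∈ K := by
  -- The atom of `v` is the smallest member containing `v` (or the ground set), minus the union of
  -- the members inside it that avoid `v`.
  obtain ⟨M, hM, hmin⟩ := Finset.exists_min_image ((insert Finset.univ L).filter (v ∈ ·))
    Finset.card ⟨Finset.univ, by simp⟩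
  rw [Finset.mem_filter, Finset.mem_insert] at hM
  have hMK : φ M ∈ K := by
    rcases hM.1 with rfl | h
    exacts [huniv, hK M h]
  have hnot : ∀ X ∈ L, ¬M.Overlaps X := by
    intro X hX h
    rcases hM.1 with rfl | h'
    · exact absurd h.2.2 (by simp [Finset.sdiff_eq_empty_iff_subset.mpr (Finset.subset_univ X)])
    · exact hL M h' X hX h
  set F := L.filter fun Y => v ∉ Y ∧ Y ⊆ M with hF
  have hFK : φ (F.biUnion id) ∈ K := by
    refine mem_biUnion_of_laminar hempty hunion F (fun X hX Y hY => ?_) fun X hX => ?_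
    · exact hL X (Finset.mem_filter.mp hX).1 Y (Finset.mem_filter.mp hY).1
    · exact hK X (Finset.mem_filter.mp hX).1
  have hsub : F.biUnion id ⊆ M :=
    Finset.biUnion_subset.mpr fun Y hY => (Finset.mem_filter.mp hY).2.2
  have hatom : (Finset.univ.filter fun u => ∀ X ∈ L, u ∈ X ↔ v ∈ X) = M \ F.biUnion id := by
    ext u
    simp only [Finset.mem_filter, Finset.mem_univ, true_and, Finset.mem_sdiff, Finset.mem_biUnion,
      id, not_exists, not_and]
    constructor
    · intro hu
      refine ⟨?_, fun Y hY huY => ?_⟩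
      · rcases hM.1 with h | h
        · exact h ▸ Finset.mem_univ u
        · exact (hu M h).mpr hM.2
      · rw [hF, Finset.mem_filter] at hY
        exact hY.2.1 ((hu Y hY.1).mp huY)
    · rintro ⟨huM, hu⟩ X hX
      constructor
      · intro huX
        by_contra hvX
        rcases not_overlaps_iff.mp (hnot X hX) with h | h | h
        · exact Finset.disjoint_left.mp h huM huX
        · exact hvX (h hM.2)
        · exact hu X (Finset.mem_filter.mpr ⟨hX, hvX, h⟩) huX
      · intro hvX
        rcases not_overlaps_iff.mp (hnot X hX) with h | h | h
        · exact absurd hvX (Finset.disjoint_left.mp h hM.2)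
        · exact h huM
        · have := hmin X (Finset.mem_filter.mpr ⟨Finset.mem_insert_of_mem hX, hvX⟩)
          exact (Finset.eq_of_subset_of_card_le h this) ▸ huM
  have hsplit := hunion _ _ (Finset.sdiff_disjoint (s := F.biUnion id) (t := M))
  rw [Finset.sdiff_union_of_subset hsub] at hsplit
  rw [hatom, eq_sub_of_add_eq hsplit.symm]
  exact sub_mem hMK hFK

end Laminar

/-! ### Integrality of extreme submodular flows. -/

section Integrality

variable {V ι : Type*} [Fintype V] [DecidableEq V] [Fintype ι]

omit [Fintype V] in
-- All terms but that of `e₀` are integers, and that term is `± x e₀`, a proper fraction.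
theorem netInflow_notMem_range_intCast {t h : ι → V} {x : ι → ℝ} {W : Finset V} {e₀ : ι}
    (he₀ : 0 < x e₀ ∧ x e₀ < 1) (hcross : ¬(h e₀ ∈ W ↔ t e₀ ∈ W))
    (hother : ∀ e, e ≠ e₀ → (x e = 0 ∨ x e = 1) ∨ (h e ∈ W ↔ t e ∈ W)) :
    netInflow t h x W ∉ (Int.castAddHom ℝ).range := by
  classical
  intro hint
  rw [netInflow, ← Finset.add_sum_erase _ _ (Finset.mem_univ e₀)] at hint
  have hrest : ∑ e ∈ Finset.univ.erase e₀,
      x e * ((if h e ∈ W then (1 : ℝ) else 0) - (if t e ∈ W then 1 else 0)) ∈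
        (Int.castAddHom ℝ).range := by
    refine sum_mem fun e he => ?_
    rcases hother e (Finset.ne_of_mem_erase he) with (h0 | h0) | h0
    · exact ⟨0, by simp [h0]⟩
    · exact ⟨(if h e ∈ W then 1 else 0) - (if t e ∈ W then 1 else 0), by simp [h0]⟩
    · exact ⟨0, by simp [h0]⟩
  have hx := (AddSubgroup.add_mem_cancel_right _ hrest).mp hint
  have key : ∀ n : ℤ, (n : ℝ) ≠ x e₀ := by
    intro n hn
    rw [← hn] at he₀
    have h1 : 0 < n := by exact_mod_cast he₀.1
    have h2 : n < 1 := by exact_mod_cast he₀.2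
    omega
  obtain ⟨n, hn⟩ := hx
  by_cases h1 : h e₀ ∈ W <;> by_cases h2 : t e₀ ∈ W <;> simp [h1, h2] at hn hcross
  · exact key n hn
  · exact key (-n) (by push_cast; linarith)

omit [Fintype V] [DecidableEq V] in
/-- A graph in which no vertex has exactly one incidence with the edge set `H ≠ ∅` carries a nonzero
circulation on `H`. -/
theorem exists_circulation {B : Type*} [DecidableEq B] (t h : ι → B) (H : Finset ι)
    (hH : H.Nonempty)
    (hdeg : ∀ b, ¬∃ e₀ ∈ H, h e₀ ≠ t e₀ ∧ (h e₀ = b ∨ t e₀ = b) ∧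
      ∀ e ∈ H, e ≠ e₀ → h e ≠ b ∧ t e ≠ b) :
    ∃ z : ι → ℝ, z ≠ 0 ∧ (∀ e ∉ H, z e = 0) ∧
      ∀ b, ∑ e, z e * ((if h e = b then 1 else 0) - (if t e = b then 1 else 0)) = 0 := by
  classical
  set S := H.image h ∪ H.image t with hS
  have hhS : ∀ e ∈ H, h e ∈ S := fun e he =>
    Finset.mem_union_left _ (Finset.mem_image_of_mem h he)
  have htS : ∀ e ∈ H, t e ∈ S := fun e he =>
    Finset.mem_union_right _ (Finset.mem_image_of_mem t he)
  -- Double counting: each vertex of `S` has at least two incidences with `H`, a loop counting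
  -- twice, and each edge has exactly two.
  have hcard : S.card ≤ H.card := by
    have htwo : ∀ b ∈ S, 2 ≤ ∑ e ∈ H, ((if h e = b then 1 else 0) + (if t e = b then 1 else 0)) := by
      intro b hb
      obtain ⟨e₀, he₀, hb₀⟩ : ∃ e₀ ∈ H, h e₀ = b ∨ t e₀ = b := by
        rcases Finset.mem_union.mp hb with hb | hb <;>
          obtain ⟨e, he, rfl⟩ := Finset.mem_image.mp hb
        exacts [⟨e, he, Or.inl rfl⟩, ⟨e, he, Or.inr rfl⟩]
      have hsplit := Finset.add_sum_erase H
        (fun e => (if h e = b then 1 else 0) + (if t e = b then 1 else 0)) he₀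
      rw [← hsplit]
      by_cases hloop : h e₀ = t e₀
      · have : t e₀ = b := by rcases hb₀ with h' | h' <;> simp [← h', hloop]
        simp [hloop, this]
      · obtain ⟨e, he, hne, hinc⟩ : ∃ e ∈ H, e ≠ e₀ ∧ (h e = b ∨ t e = b) := by
          by_contra hcon
          push Not at hcon
          exact hdeg b ⟨e₀, he₀, hloop, hb₀, hcon⟩
        have h1 : 1 ≤ (if h e₀ = b then 1 else 0) + (if t e₀ = b then 1 else 0) := by
          rcases hb₀ with h' | h' <;> simp [h']
        have h2 : 1 ≤ ∑ e ∈ H.erase e₀, ((if h e = b then 1 else 0) + (if t e = b then 1 else 0)) := by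
          refine le_trans ?_ (Finset.single_le_sum (fun _ _ => Nat.zero_le _)
            (Finset.mem_erase.mpr ⟨hne, he⟩))
          rcases hinc with h' | h' <;> simp [h']
        exact Nat.add_le_add h1 h2
    have hsum : ∑ b ∈ S, ∑ e ∈ H, ((if h e = b then 1 else 0) + (if t e = b then 1 else 0)) =
        2 * H.card := by
      rw [Finset.sum_comm, mul_comm, ← smul_eq_mul, ← Finset.sum_const]
      refine Finset.sum_congr rfl fun e he => ?_
      rw [Finset.sum_add_distrib]
      simp [hhS e he, htS e he]
    have := Finset.sum_le_sum htwo
    rw [hsum, Finset.sum_const, smul_eq_mul] at this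
    omega
  obtain ⟨e₁, he₁⟩ := hH
  set b₀ := h e₁
  -- The balance equation at `b₀` is dropped, leaving fewer equations than unknowns. It follows from
  -- the others because all the balances sum to zero.
  let Φ : (H → ℝ) →ₗ[ℝ] (↥(S.erase b₀) → ℝ) :=
    { toFun := fun w b => ∑ e : H, w e * ((if h e = b then 1 else 0) - (if t e = b then 1 else 0))
      map_add' := fun w w' => by
        ext b
        simp [add_mul, Finset.sum_add_distrib]
      map_smul' := fun c w => by
        ext b
        simp [Finset.mul_sum, mul_assoc] }
  have hker : LinearMap.ker Φ ≠ ⊥ := by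
    apply LinearMap.ker_ne_bot_of_finrank_lt
    simp only [Module.finrank_fintype_fun_eq_card, Fintype.card_coe]
    exact (Finset.card_erase_lt_of_mem (hhS e₁ he₁)).trans_le hcard
  obtain ⟨w, hw, hw0⟩ := (Submodule.ne_bot_iff _).mp hker
  let z : ι → ℝ := fun e => if he : e ∈ H then w ⟨e, he⟩ else 0
  have hzH : ∀ e ∉ H, z e = 0 := fun e he => dif_neg he
  have hzw : ∀ e : H, z e = w e := fun e => by simp [z]
  have hsumH : ∀ f : ι → ℝ, ∑ e, z e * f e = ∑ e : H, w e * f e := by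
    intro f
    rw [← Finset.sum_subset (Finset.subset_univ H) (fun e _ he => by simp [hzH e he]),
      ← Finset.sum_coe_sort]
    simp [hzw]
  have hN : ∀ b, b ≠ b₀ →
      ∑ e, z e * ((if h e = b then 1 else 0) - (if t e = b then 1 else 0)) = 0 := by
    intro b hb
    by_cases hbS : b ∈ S
    · have := congrFun (LinearMap.mem_ker.mp hw) ⟨b, Finset.mem_erase.mpr ⟨hb, hbS⟩⟩
      rw [hsumH]
      exact this
    · refine Finset.sum_eq_zero fun e _ => ?_
      by_cases he : e ∈ H
      · have h1 : h e ≠ b := fun h' => hbS (h' ▸ hhS e he)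
        have h2 : t e ≠ b := fun h' => hbS (h' ▸ htS e he)
        simp [h1, h2]
      · simp [hzH e he]
  refine ⟨z, ?_, hzH, ?_⟩
  · rintro hz
    exact hw0 (funext fun e => by rw [← hzw, hz]; rfl)
  · intro b
    by_cases hb : b = b₀
    · have htot : ∑ b ∈ S, ∑ e, z e * ((if h e = b then 1 else 0) - (if t e = b then 1 else 0)) =
          0 := by
        rw [Finset.sum_comm]
        refine Finset.sum_eq_zero fun e _ => ?_
        by_cases he : e ∈ H
        · rw [← Finset.mul_sum, Finset.sum_sub_distrib]
          simp [hhS e he, htS e he]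
        · simp [hzH e he]
      rw [Finset.sum_eq_single_of_mem b₀ (hhS e₁ he₁) fun b _ hb => hN b hb] at htot
      rw [hb, htot]
    · exact hN b hb

omit [Fintype V] in
-- `X` is a union of fibres of `β`, so its inflow is the sum of the balances at these fibres.
theorem netInflow_eq_zero_of_circulation {B : Type*} [Fintype B] [DecidableEq B] {t h : ι → V}
    {z : ι → ℝ} (β : V → B)
    (hz : ∀ b, ∑ e, z e * ((if β (h e) = b then 1 else 0) - (if β (t e) = b then 1 else 0)) = 0)
    {X : Finset V} {P : B → Prop} (hX : ∀ v, v ∈ X ↔ P (β v)) : netInflow t h z X = 0 := by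
  classical
  have : netInflow t h z X = ∑ b, (if P b then 1 else 0) *
      ∑ e, z e * ((if β (h e) = b then 1 else 0) - (if β (t e) = b then 1 else 0)) := by
    simp only [Finset.mul_sum]
    rw [Finset.sum_comm, netInflow]
    refine Finset.sum_congr rfl fun e _ => ?_
    have : ∀ b, (if P b then (1 : ℝ) else 0) *
        (z e * ((if β (h e) = b then 1 else 0) - (if β (t e) = b then 1 else 0))) =
        z e * ((if β (h e) = b then (if P b then 1 else 0) else 0) -
          (if β (t e) = b then (if P b then 1 else 0) else 0)) := by
      intro b
      split_ifs <;> ring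
    simp only [this]
    rw [← Finset.mul_sum, Finset.sum_sub_distrib]
    simp [hX]
  rw [this]
  simp [hz]

/-- Integrality of extreme submodular flows (Edmonds and Giles). -/
theorem eq_zero_or_eq_one_of_mem_extremePoints_submodularFlows {t h : ι → V} {g : Finset V → ℤ}
    (hg : ∀ X Y : Finset V, (X ∩ Y).Nonempty → X ∪ Y ≠ Finset.univ →
      g X + g Y ≤ g (X ∩ Y) + g (X ∪ Y))
    {x : ι → ℝ} (hx : x ∈ (submodularFlows t h g).extremePoints ℝ) (e : ι) :
    x e = 0 ∨ x e = 1 := by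
  classical
  by_contra hfrac
  set H := Finset.univ.filter fun e => ¬(x e = 0 ∨ x e = 1) with hH
  have hHx : ∀ e, e ∉ H → x e = 0 ∨ x e = 1 := fun e he => by
    by_contra h'
    exact he (Finset.mem_filter.mpr ⟨Finset.mem_univ _, h'⟩)
  -- Any vertex would do as a root. For sets avoiding `r`, unions are proper and complements meet,
  -- as uncrossing two sets or two complements requires.
  set r := t e
  set tight : Finset V → Prop := fun X => netInflow t h x X = g X with htight
  have huncross : ∀ X Y, tight X → tight Y → (X ∩ Y).Nonempty → X ∪ Y ≠ Finset.univ →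
      tight (X ∩ Y) ∧ tight (X ∪ Y) := by
    intro X Y hX hY hinter hunion
    have h1 := hx.1.2 (X ∩ Y) hinter fun h' => hunion <| by
      rw [Finset.eq_univ_iff_forall] at h' ⊢
      exact fun v => Finset.mem_union_left _ (Finset.mem_inter.mp (h' v)).1
    have h2 := hx.1.2 (X ∪ Y)
      (hinter.mono (Finset.inter_subset_left.trans Finset.subset_union_left)) hunion
    have h3 : (g X : ℝ) + g Y ≤ g (X ∩ Y) + g (X ∪ Y) := by exact_mod_cast hg X Y hinter hunion
    have h4 := netInflow_inter_add_union t h x X Y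
    simp only [htight] at hX hY ⊢
    constructor <;> linarith
  set T := Finset.univ.filter fun X : Finset V => r ∉ X ∧ X.Nonempty ∧ (tight X ∨ tight Xᶜ) with hTdef
  have hmemT : ∀ X, X ∈ T ↔ r ∉ X ∧ X.Nonempty ∧ (tight X ∨ tight Xᶜ) := by simp [hTdef]
  have hT : ∀ X ∈ T, ∀ Y ∈ T, Y.Overlaps X →
      (X ∩ Y ∈ T ∧ X ∪ Y ∈ T) ∨ (X \ Y ∈ T ∧ Y \ X ∈ T) := by
    intro X hX Y hY hYX
    rw [hmemT] at hX hY
    simp only [hmemT]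
    obtain ⟨hinter, hYmX, hXmY⟩ := hYX
    rw [Finset.inter_comm] at hinter
    have hr : r ∉ X ∪ Y := by simp [hX.1, hY.1]
    have hunion : (X ∪ Y).Nonempty := hX.2.1.mono Finset.subset_union_left
    have hri : r ∉ X ∩ Y := fun h' => hX.1 (Finset.mem_inter.mp h').1
    have hr1 : r ∉ X \ Y := fun h' => hX.1 (Finset.mem_sdiff.mp h').1
    have hr2 : r ∉ Y \ X := fun h' => hY.1 (Finset.mem_sdiff.mp h').1
    have ne_univ : ∀ {Z W : Finset V}, Z.Nonempty → W = Zᶜ → W ≠ Finset.univ := by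
      rintro Z W hZ rfl h'
      rw [Finset.compl_eq_univ_iff] at h'
      exact hZ.ne_empty h'
    have e1 : X ∩ Yᶜ = X \ Y := by ext v; simp
    have e2 : Y ∩ Xᶜ = Y \ X := by ext v; simp
    have e3 : X ∪ Yᶜ = (Y \ X)ᶜ := by ext v; simp; tauto
    have e4 : Y ∪ Xᶜ = (X \ Y)ᶜ := by ext v; simp; tauto
    have e5 : Xᶜ ∩ Yᶜ = (X ∪ Y)ᶜ := by ext v; simp
    have e6 : Xᶜ ∪ Yᶜ = (X ∩ Y)ᶜ := by ext v; simp
    rcases hX.2.2 with tX | tX <;> rcases hY.2.2 with tY | tY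
    -- If both sets or both complements are tight, intersection and union stay in `T`; in the mixed
    -- cases the two differences do.
    · have := huncross X Y tX tY hinter fun h' => hr (h' ▸ Finset.mem_univ r)
      exact Or.inl ⟨⟨hri, hinter, Or.inl this.1⟩, hr, hunion, Or.inl this.2⟩
    · have := huncross X Yᶜ tX tY (e1 ▸ hXmY) (ne_univ hYmX e3)
      rw [e1, e3] at this
      exact Or.inr ⟨⟨hr1, hXmY, Or.inl this.1⟩, hr2, hYmX, Or.inr this.2⟩
    · have := huncross Y Xᶜ tY tX (e2 ▸ hYmX) (ne_univ hXmY e4)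
      rw [e2, e4] at this
      exact Or.inr ⟨⟨hr1, hXmY, Or.inr this.2⟩, hr2, hYmX, Or.inl this.1⟩
    · have := huncross Xᶜ Yᶜ tX tY ⟨r, by simp [hX.1, hY.1]⟩ (ne_univ hinter e6)
      rw [e5, e6] at this
      exact Or.inl ⟨⟨hri, hinter, Or.inr this.2⟩, hr, hunion, Or.inr this.1⟩
  obtain ⟨L, hLT, hL, hmax⟩ := exists_maximal_laminar T
  have hint : ∀ X ∈ L, netInflow t h x X ∈ (Int.castAddHom ℝ).range := by
    intro X hX
    rcases ((hmemT X).mp (hLT hX)).2.2 with h' | h'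
    · exact ⟨g X, h'.symm⟩
    · rw [← neg_mem_iff, ← netInflow_compl]
      exact ⟨g Xᶜ, h'.symm⟩
  have hatom := mem_atom_of_laminar (netInflow_empty t h x)
    (fun X Y => netInflow_union_of_disjoint t h x)
    (by rw [netInflow_univ]; exact zero_mem _) hL hint
  -- `β` contracts each atom of `L` to a point. Integral inflow into an atom excludes exactly one
  -- fractional incidence there, which is what the circulation on the contracted graph needs.
  set β : V → Finset (Finset V) := fun v => L.filter (v ∈ ·) with hβ
  have hβ_iff : ∀ u v, β u = β v ↔ ∀ X ∈ L, u ∈ X ↔ v ∈ X := by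
    intro u v
    simp only [hβ, Finset.ext_iff, Finset.mem_filter, and_congr_right_iff]
  obtain ⟨z, hz0, hzH, hz⟩ := exists_circulation (fun e => β (t e)) (fun e => β (h e)) H
    ⟨e, Finset.mem_filter.mpr ⟨Finset.mem_univ _, hfrac⟩⟩ (by
      rintro b ⟨e₀, he₀, hne, hinc, hother⟩
      obtain ⟨v, rfl⟩ : ∃ v, b = β v := by
        rcases hinc with h' | h'
        exacts [⟨_, h'.symm⟩, ⟨_, h'.symm⟩]
      have hmem : ∀ u, u ∈ (Finset.univ.filter fun u => ∀ X ∈ L, u ∈ X ↔ v ∈ X) ↔ β u = β v := by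
        simp [hβ_iff]
      refine netInflow_notMem_range_intCast (e₀ := e₀) ?_ ?_ ?_ (hatom v)
      · have hb := hx.1.1 e₀
        have := (Finset.mem_filter.mp he₀).2
        push Not at this
        exact ⟨lt_of_le_of_ne hb.1 this.1.symm, lt_of_le_of_ne hb.2 this.2⟩
      · rw [hmem, hmem]
        intro hiff
        rcases hinc with h' | h'
        · exact hne (h'.trans (hiff.mp h').symm)
        · exact hne ((hiff.mpr h').trans h'.symm)
      · intro e' he'
        by_cases heH : e' ∈ H
        · rw [hmem, hmem]
          have := hother e' heH he'
          exact Or.inr ⟨fun h' => absurd h' this.1, fun h' => absurd h' this.2⟩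
        · exact Or.inl (hHx e' heH))
  have hzL : ∀ X ∈ L, netInflow t h z X = 0 := fun X hX =>
    netInflow_eq_zero_of_circulation β hz (P := fun b => X ∈ b) fun v => by simp [hβ, hX]
  have hzT := eq_zero_of_eq_zero_on_maximal_laminar hLT hL hmax hT
    (netInflow_inter_add_union t h z) (fun X Y => by
      have h1 := netInflow_sdiff t h z (Finset.inter_subset_left (s₁ := X) (s₂ := Y))
      have h2 := netInflow_sdiff t h z (Finset.inter_subset_right (s₁ := X) (s₂ := Y))
      rw [Finset.sdiff_inter_self_left] at h1
      rw [Finset.sdiff_inter_self_right] at h2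
      linarith) hzL
  refine hz0 (eq_zero_of_mem_extremePoints_submodularFlows hx (fun e he => hzH e fun h' =>
    (Finset.mem_filter.mp h').2 he) fun X hX hXu htX => ?_)
  by_cases hr : r ∈ X
  · have := hzT Xᶜ ((hmemT _).mpr ⟨by simpa using hr, ?_, Or.inr (by rwa [compl_compl])⟩)
    · rw [netInflow_compl] at this
      linarith
    · rw [Finset.nonempty_iff_ne_empty]
      simpa [Finset.compl_eq_empty_iff] using hXu
  · exact hzT X ((hmemT X).mpr ⟨hr, hX, Or.inl htX⟩)

/-- A nonempty submodular flow polytope contains a `0`-`1` vector. -/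
theorem exists_integral_submodularFlow {t h : ι → V} {g : Finset V → ℤ}
    (hg : ∀ X Y : Finset V, (X ∩ Y).Nonempty → X ∪ Y ≠ Finset.univ →
      g X + g Y ≤ g (X ∩ Y) + g (X ∪ Y))
    (hne : (submodularFlows t h g).Nonempty) :
    ∃ x ∈ submodularFlows t h g, ∀ e, x e = 0 ∨ x e = 1 := by
  obtain ⟨x, hx⟩ := (isCompact_submodularFlows t h g).extremePoints_nonempty hne
  exact ⟨x, hx.1, eq_zero_or_eq_one_of_mem_extremePoints_submodularFlows hg hx⟩

end Integrality

/-! ### The span modulo 2 of the cliques on `p` vertices. -/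

section Cliques

theorem add_self_eq_zero_of_zmod_two {α : Type*} (f : α → ZMod 2) : f + f = 0 :=
  funext fun _ => CharTwo.add_self_eq_zero _

variable {V : Type*} [DecidableEq V]

/-- The indicator vector modulo `2` of the edges of the complete graph on `X`. -/
def cliqueVector (X : Finset V) : Sym2 V → ZMod 2 :=
  fun e => if ¬e.IsDiag ∧ e ∈ X.sym2 then 1 else 0

theorem cliqueVector_mk (X : Finset V) (u v : V) :
    cliqueVector X s(u, v) = if u ≠ v ∧ u ∈ X ∧ v ∈ X then 1 else 0 := by
  simp [cliqueVector]

theorem cliqueVector_insert {X : Finset V} {a : V} (ha : a ∉ X) :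
    cliqueVector (insert a X) = cliqueVector X + ∑ z ∈ X, Pi.single s(a, z) 1 := by
  funext e
  induction e using Sym2.ind with
  | _ u v =>
    simp only [Pi.add_apply, Finset.sum_apply, cliqueVector_mk, Pi.single_apply, Sym2.eq_iff,
      Finset.mem_insert]
    by_cases hu : u = a
    · subst hu
      by_cases hv : v = u
      · subst hv
        have : ∀ z ∈ X, ¬(v = z) := fun z hz h' => ha (h' ▸ hz)
        simp +contextual [ha, this]
      · simp [ha, hv, Ne.symm hv, Finset.sum_ite_eq]
    · by_cases hv : v = a
      · subst hv
        simp [ha, hu, Finset.sum_ite_eq]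
      · simp [hu, hv]

variable [Fintype V]

/-- The span modulo `2` of the cliques on `p` vertices. -/
def cliqueSpan (V : Type*) [DecidableEq V] (p : ℕ) : Submodule (ZMod 2) (Sym2 V → ZMod 2) :=
  Submodule.span (ZMod 2) (Set.range fun X : {X : Finset V // X.card = p} => cliqueVector X.1)

omit [Fintype V] in
theorem cliqueVector_mem_cliqueSpan {p : ℕ} {X : Finset V} (hX : X.card = p) :
    cliqueVector X ∈ cliqueSpan V p :=
  Submodule.subset_span ⟨⟨X, hX⟩, rfl⟩

omit [Fintype V] in
-- Add the cliques on `Z ∪ {a}` and `Z ∪ {b}`: the clique on `Z` cancels, and the paths `a z b`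
-- remain.
theorem sum_path_mem_cliqueSpan {p : ℕ} {a b : V} {Z : Finset V}
    (ha : a ∉ Z) (hb : b ∉ Z) (hZ : Z.card + 1 = p) :
    ∑ z ∈ Z, (Pi.single s(a, z) 1 + Pi.single s(b, z) 1 : Sym2 V → ZMod 2) ∈ cliqueSpan V p := by
  have h := add_mem
    (cliqueVector_mem_cliqueSpan (by rw [Finset.card_insert_of_notMem ha, hZ]))
    (cliqueVector_mem_cliqueSpan (by rw [Finset.card_insert_of_notMem hb, hZ]))
  rw [cliqueVector_insert ha, cliqueVector_insert hb] at h
  rw [Finset.sum_add_distrib]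
  have h2 := add_self_eq_zero_of_zmod_two (cliqueVector Z)
  convert h using 1
  rw [add_add_add_comm, h2, zero_add]

/-- Exchanging one vertex of `Z` shows that all paths `a z b` agree modulo the span. A sum over `Z`
has `p - 1` terms, an odd number, so it reduces to a single path. -/
theorem path_mem_cliqueSpan {p : ℕ} (hp : 2 ≤ p) (hp_even : Even p) (hcard : p + 2 ≤ Fintype.card V)
    {a b c : V} (hac : c ≠ a) (hbc : c ≠ b) :
    (Pi.single s(a, c) 1 + Pi.single s(b, c) 1 : Sym2 V → ZMod 2) ∈ cliqueSpan V p := by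
  set P : V → Sym2 V → ZMod 2 := fun z => Pi.single s(a, z) 1 + Pi.single s(b, z) 1 with hP
  have hswap : ∀ z, z ≠ a → z ≠ b → z ≠ c → P z - P c ∈ cliqueSpan V p := by
    intro z hza hzb hzc
    -- `W` is the common part of the two sets `Z`. Finding `p - 2` vertices besides `a, b, c, z` is
    -- what uses `n ≥ p + 2`.
    obtain ⟨W, hW, hWcard⟩ := Finset.exists_subset_card_eq
      (s := (Finset.univ \ {a, b, c, z} : Finset V)) (n := p - 2) (by
        have h1 := Finset.le_card_sdiff ({a, b, c, z} : Finset V) Finset.univ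
        have h2 := Finset.card_le_four (a := a) (b := b) (c := c) (d := z)
        rw [Finset.card_univ] at h1
        omega)
    have hnot : ∀ v ∈ ({a, b, c, z} : Finset V), v ∉ W := fun v hv h' =>
      (Finset.mem_sdiff.mp (hW h')).2 hv
    have haW := hnot a (by simp)
    have hbW := hnot b (by simp)
    have hcW := hnot c (by simp)
    have hzW := hnot z (by simp)
    have h1 := sum_path_mem_cliqueSpan (p := p) (a := a) (b := b) (Z := insert z W) (by simp [haW, hza.symm])
      (by simp [hbW, hzb.symm]) (by rw [Finset.card_insert_of_notMem hzW]; omega)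
    have h2 := sum_path_mem_cliqueSpan (p := p) (a := a) (b := b) (Z := insert c W) (by simp [haW, hac.symm])
      (by simp [hbW, hbc.symm]) (by rw [Finset.card_insert_of_notMem hcW]; omega)
    rw [Finset.sum_insert hzW] at h1
    rw [Finset.sum_insert hcW] at h2
    simpa [hP] using sub_mem h1 h2
  obtain ⟨Z, hcZ, hZ, hZcard⟩ := Finset.exists_subsuperset_card_eq
    (s := {c}) (t := (Finset.univ \ {a, b} : Finset V)) (n := p - 1) (by simp [hac, hbc])
    (by simp; omega) (by
      have h1 := Finset.le_card_sdiff ({a, b} : Finset V) Finset.univ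
      have h2 := Finset.card_le_two (a := a) (b := b)
      rw [Finset.card_univ] at h1
      omega)
  have hnot : ∀ v ∈ Z, v ≠ a ∧ v ≠ b := fun v hv => by
    have := (Finset.mem_sdiff.mp (hZ hv)).2
    simpa using this
  have hsum := sum_path_mem_cliqueSpan (p := p) (Z := Z) (fun h' => (hnot a h').1 rfl)
    (fun h' => (hnot b h').2 rfl) (by omega)
  have hdiff : ∑ z ∈ Z, (P z - P c) ∈ cliqueSpan V p := by
    refine sum_mem fun z hz => ?_
    by_cases hzc : z = c
    · simp [hzc]
    · exact hswap z (hnot z hz).1 (hnot z hz).2 hzc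
  have h := sub_mem hsum hdiff
  rw [Finset.sum_sub_distrib, sub_sub_cancel, Finset.sum_const, hZcard] at h
  have hodd : Odd (p - 1) := Nat.Even.sub_odd (by omega) hp_even odd_one
  obtain ⟨m, hm⟩ := hodd
  rwa [hm, add_smul, one_smul, mul_comm, mul_smul, two_smul, add_self_eq_zero_of_zmod_two, smul_zero, zero_add] at h

/-- Two edges sharing an endpoint differ by a path of length two; arbitrary edges `ab` and `cd` are
linked through `bc`. -/
theorem single_sub_single_mem_cliqueSpan {p : ℕ} (hp : 2 ≤ p) (hp_even : Even p)
    (hcard : p + 2 ≤ Fintype.card V) {a b c d : V} (hab : a ≠ b) (hcd : c ≠ d) :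
    (Pi.single s(a, b) 1 - Pi.single s(c, d) 1 : Sym2 V → ZMod 2) ∈ cliqueSpan V p := by
  have step : ∀ {u v w : V}, w ≠ u → w ≠ v →
      (Pi.single s(u, w) 1 - Pi.single s(v, w) 1 : Sym2 V → ZMod 2) ∈ cliqueSpan V p := by
    intro u v w hu hv
    rw [sub_eq_add_neg, ← eq_neg_of_add_eq_zero_left (add_self_eq_zero_of_zmod_two _)]
    exact path_mem_cliqueSpan hp hp_even hcard hu hv
  by_cases hbc : b = c
  · subst hbc
    have := step (u := a) (v := d) (w := b) hab.symm hcd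
    rwa [Sym2.eq_swap (a := d)] at this
  · have h1 := step (u := a) (v := c) (w := b) hab.symm hbc
    have h2 := step (u := b) (v := d) (w := c) (Ne.symm hbc) hcd
    rw [Sym2.eq_swap (a := b), Sym2.eq_swap (a := d)] at h2
    simpa using add_mem h1 h2

/-- Every edge set of even size is a sum modulo `2` of cliques on `p` vertices. -/
theorem mem_cliqueSpan_of_sum_eq_zero {p : ℕ} (hp : 2 ≤ p) (hp_even : Even p)
    (hcard : p + 2 ≤ Fintype.card V) {f : Sym2 V → ZMod 2} (hdiag : ∀ e, e.IsDiag → f e = 0)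
    (hsum : ∑ e, f e = 0) : f ∈ cliqueSpan V p := by
  obtain ⟨c, d, hcd⟩ : ∃ c d : V, c ≠ d :=
    Fintype.exists_pair_of_one_lt_card (by omega)
  -- Subtracting a fixed edge `cd` from every term changes nothing, since the coefficients sum to
  -- zero.
  have hf : f = ∑ e, f e • (Pi.single e 1 - Pi.single s(c, d) 1 : Sym2 V → ZMod 2) := by
    simp only [smul_sub, Finset.sum_sub_distrib]
    rw [← Finset.sum_smul, hsum, zero_smul, sub_zero]
    funext e
    simp [Pi.single_apply]
  rw [hf]
  refine sum_mem fun e _ => ?_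
  by_cases he : e.IsDiag
  · simp [hdiag e he]
  · refine Submodule.smul_mem _ _ ?_
    induction e using Sym2.ind with
    | _ a b => exact single_sub_single_mem_cliqueSpan hp hp_even hcard (by simpa using he) hcd

theorem exists_sum_cliqueVector_of_mem_cliqueSpan {p : ℕ} {f : Sym2 V → ZMod 2}
    (hf : f ∈ cliqueSpan V p) :
    ∃ 𝒳 : Finset (Finset V), (∀ X ∈ 𝒳, X.card = p) ∧ f = ∑ X ∈ 𝒳, cliqueVector X := by
  obtain ⟨c, rfl⟩ := (Submodule.mem_span_range_iff_exists_fun _).mp hf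
  refine ⟨(Finset.univ.filter fun X => c X = 1).map (Function.Embedding.subtype _), ?_, ?_⟩
  · intro X hX
    obtain ⟨Y, -, rfl⟩ := Finset.mem_map.mp hX
    exact Y.2
  · rw [Finset.sum_map, Finset.sum_filter]
    refine Finset.sum_congr rfl fun X _ => ?_
    have h01 : ∀ y : ZMod 2, y = 0 ∨ y = 1 := by decide
    rcases h01 (c X) with h | h <;> simp [h]

end Cliques

/-! ### Orientations with large out-degrees. -/

section Orientation

variable {V : Type*} [Fintype V] [DecidableEq V]

/-- The number of arcs in `A` leaving `X`. -/
def outDegree (A : Finset (V × V)) (X : Finset V) : ℕ :=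
  (A.filter fun a => a.1 ∈ X ∧ a.2 ∉ X).card

omit [Fintype V] in
theorem outDegree_eq_sum (A : Finset (V × V)) (X : Finset V) :
    outDegree A X = ∑ a ∈ A, if a.1 ∈ X ∧ a.2 ∉ X then 1 else 0 :=
  Finset.card_filter _ _

omit [Fintype V] in
theorem outDegree_inter_add_union_le (A : Finset (V × V)) (X Y : Finset V) :
    outDegree A (X ∩ Y) + outDegree A (X ∪ Y) ≤ outDegree A X + outDegree A Y := by
  simp only [outDegree_eq_sum, ← Finset.sum_add_distrib]
  refine Finset.sum_le_sum fun a _ => ?_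
  by_cases h1 : a.1 ∈ X <;> by_cases h2 : a.1 ∈ Y <;> by_cases h3 : a.2 ∈ X <;>
    by_cases h4 : a.2 ∈ Y <;> simp [h1, h2, h3, h4]

omit [Fintype V] in
theorem outDegree_union_of_disjoint {A B : Finset (V × V)} (hAB : Disjoint A B) (X : Finset V) :
    outDegree (A ∪ B) X = outDegree A X + outDegree B X := by
  simp only [outDegree_eq_sum, Finset.sum_union hAB]

omit [Fintype V] in
theorem outDegree_sdiff_add {A B : Finset (V × V)} (hBA : B ⊆ A) (X : Finset V) :
    outDegree (A \ B) X + outDegree B X = outDegree A X := by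
  rw [← outDegree_union_of_disjoint Finset.sdiff_disjoint, Finset.sdiff_union_of_subset hBA]

theorem outDegree_image_swap (A : Finset (V × V)) (X : Finset V) :
    outDegree (A.image Prod.swap) X = outDegree A Xᶜ := by
  simp only [outDegree_eq_sum]
  rw [Finset.sum_image Prod.swap_injective.injOn]
  simp [and_comm]

theorem sum_net_eq_outDegree_sub (A : Finset (V × V)) (X : Finset V) :
    ∑ a ∈ A, ((if a.2 ∈ X then (1 : ℝ) else 0) - (if a.1 ∈ X then 1 else 0)) =
      outDegree A Xᶜ - outDegree A X := by
  simp only [outDegree_eq_sum, Nat.cast_sum, ← Finset.sum_sub_distrib]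
  refine Finset.sum_congr rfl fun a _ => ?_
  by_cases h1 : a.1 ∈ X <;> by_cases h2 : a.2 ∈ X <;> simp [h1, h2]

/-- The weak orientation theorem of Nash-Williams in the presence of digons: if every cut of `A` has
at least `2 * k` arcs, then reversing some of the arcs that lie in no digon makes all out-degrees of
cuts at least `k`. -/
theorem exists_reversal_forall_le_outDegree {A : Finset (V × V)} {k : ℕ}
    (hA : ∀ X : Finset V, X.Nonempty → X ≠ Finset.univ →
      2 * k ≤ outDegree A X + outDegree A Xᶜ) :
    ∃ R ⊆ A, (∀ a ∈ R, a.swap ∉ A) ∧ ∀ X : Finset V, X.Nonempty → X ≠ Finset.univ →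
      k ≤ outDegree ((A \ R) ∪ R.image Prod.swap) X := by
  classical
  -- Only these arcs are variables: digons, and loops as well, equal their own reverse and
  -- contribute equally to both sides of a cut.
  set F := A.filter fun a => a.swap ∉ A with hF
  have hFA : F ⊆ A := Finset.filter_subset _ _
  have hdigons : (A \ F).image Prod.swap = A \ F := by
    ext ⟨u, v⟩
    simp only [hF, Finset.mem_image, Finset.mem_sdiff, Finset.mem_filter, Prod.exists,
      Prod.swap_prod_mk, Prod.mk.injEq]
    constructor
    · rintro ⟨b, c, h, rfl, rfl⟩
      tauto
    · intro h
      exact ⟨v, u, by tauto, rfl, rfl⟩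
  have hbal : ∀ X, outDegree (A \ F) X = outDegree (A \ F) Xᶜ := fun X => by
    rw [← outDegree_image_swap, hdigons]
  have hnet : ∀ (x : F → ℝ) (c : ℝ) (R : Finset (V × V)) (hR : R ⊆ F),
      (∀ a, x a = if a.1 ∈ R then c else 0) → ∀ X,
      netInflow (fun a : F => a.1.1) (fun a : F => a.1.2) x X =
        c * (outDegree R Xᶜ - outDegree R X) := by
    intro x c R hR hx X
    rw [← sum_net_eq_outDegree_sub, Finset.mul_sum, netInflow]
    simp only [hx]
    rw [Finset.sum_coe_sort F fun a => (if a ∈ R then c else 0) *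
      ((if a.2 ∈ X then (1 : ℝ) else 0) - (if a.1 ∈ X then 1 else 0))]
    rw [← Finset.sum_subset hR fun a _ ha => by simp [ha]]
    exact Finset.sum_congr rfl fun a ha => by simp [ha]
  -- Reversing arcs raises the out-degree of `X` by their net inflow into `X`, so `g X` is the
  -- required increase. At the constant flow `1 / 2` the out-degree becomes half the size of the
  -- cut, which is at least `k`.
  obtain ⟨x, hx, hx01⟩ := exists_integral_submodularFlow (t := fun a : F => a.1.1)
    (h := fun a : F => a.1.2) (g := fun X => (k : ℤ) - outDegree A X)
    (fun X Y _ _ => by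
      have := outDegree_inter_add_union_le A X Y
      omega)
    ⟨fun _ => 1 / 2, fun _ => by norm_num, fun X hX hXu => by
      rw [hnet _ (1 / 2) F subset_rfl (fun a => by simp)]
      have h1 : (2 * k : ℝ) ≤ outDegree A X + outDegree A Xᶜ := by exact_mod_cast hA X hX hXu
      have h2 : (outDegree (A \ F) X + outDegree F X : ℝ) = outDegree A X := by
        exact_mod_cast outDegree_sdiff_add hFA X
      have h3 : (outDegree (A \ F) Xᶜ + outDegree F Xᶜ : ℝ) = outDegree A Xᶜ := by
        exact_mod_cast outDegree_sdiff_add hFA Xᶜ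
      have h4 : (outDegree (A \ F) X : ℝ) = outDegree (A \ F) Xᶜ := by exact_mod_cast hbal X
      push_cast
      linarith⟩
  set R := (Finset.univ.filter fun a : F => x a = 1).map (Function.Embedding.subtype _) with hR
  have hmem : ∀ a : F, a.1 ∈ R ↔ x a = 1 := by simp [hR]
  have hRF : R ⊆ F := fun a ha => by
    obtain ⟨b, -, rfl⟩ := Finset.mem_map.mp ha
    exact b.2
  have hswap : ∀ a ∈ R, a.swap ∉ A := fun a ha => (Finset.mem_filter.mp (hRF ha)).2
  refine ⟨R, hRF.trans hFA, hswap, fun X hX hXu => ?_⟩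
  have hdisj : Disjoint (A \ R) (R.image Prod.swap) := by
    rw [Finset.disjoint_right]
    intro a ha ha'
    obtain ⟨b, hb, rfl⟩ := Finset.mem_image.mp ha
    exact hswap b hb (Finset.mem_sdiff.mp ha').1
  have h1 := hx.2 X hX hXu
  rw [hnet x 1 R hRF (fun a => by
    by_cases h : a.1 ∈ R
    · simp [h, (hmem a).mp h]
    · simp [h, (hx01 a).resolve_right fun h' => h ((hmem a).mpr h')]), one_mul] at h1
  have h2 := outDegree_sdiff_add (hRF.trans hFA) X
  rw [outDegree_union_of_disjoint hdisj, outDegree_image_swap]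
  have h3 : (k : ℤ) - outDegree A X ≤ outDegree R Xᶜ - outDegree R X := by exact_mod_cast h1
  omega

end Orientation

/-! ### Cuts and connectivity. -/

namespace Digraph

variable {V : Type*} [Fintype V] [DecidableEq V]

theorem isKArcStrong_of_forall_le_outDegree (D : Digraph V) {k : ℕ}
    {B : Finset (V × V)} (hB : ∀ a ∈ B, D.Adj a.1 a.2)
    (hk : ∀ X : Finset V, X.Nonempty → X ≠ Finset.univ → k ≤ outDegree B X) :
    D.IsKArcStrong k := by
  classical
  intro F hF hFk u v
  by_contra huv
  set X := Finset.univ.filter fun w =>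
    Relation.ReflTransGen (D.deleteArcs (F : Set (V × V))).Adj u w with hX
  have hle := hk X ⟨u, by simp [hX, Relation.ReflTransGen.refl]⟩ fun h => huv <| by
    have := h ▸ Finset.mem_univ v
    simpa [hX] using this
  have : outDegree B X ≤ F.card := by
    refine Finset.card_le_card fun a ha => ?_
    obtain ⟨haB, h1, h2⟩ := Finset.mem_filter.mp ha
    by_contra haF
    simp only [hX, Finset.mem_filter, Finset.mem_univ, true_and] at h1 h2
    exact h2 (h1.tail ⟨hB a haB, by simpa using haF⟩)
  omega

theorem IsKEdgeConnected.le_outDegree_add {D : Digraph V} {m : ℕ} (hD : D.IsKEdgeConnected m)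
    {A : Finset (V × V)} (hA : ∀ a, a ∈ A ↔ D.Adj a.1 a.2) {X : Finset V} (hX : X.Nonempty)
    (hXu : X ≠ Finset.univ) : m ≤ outDegree A X + outDegree A Xᶜ := by
  classical
  by_contra! hlt
  set F := (A.filter fun a => a.1 ∈ X ∧ a.2 ∉ X) ∪ (A.filter fun a => a.1 ∈ Xᶜ ∧ a.2 ∉ Xᶜ) with hF
  have hcard : F.card < m := (Finset.card_union_le _ _).trans_lt hlt
  obtain ⟨u, hu⟩ := hX
  obtain ⟨v, hv⟩ : ∃ v, v ∉ X := by
    by_contra! h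
    exact hXu (Finset.eq_univ_iff_forall.mpr h)
  have hconn := hD F (fun a ha => by
    have : a ∈ A := by
      simp only [hF, Finset.coe_union, Finset.coe_filter, Set.mem_union] at ha
      exact ha.elim And.left And.left
    exact (hA a).mp this) hcard u (Set.mem_univ u) v (Set.mem_univ v)
  suffices H : ∀ w, Relation.ReflTransGen (D.underlyingGraph.deleteEdges F).Adj u w → w ∈ X from
    hv (H v hconn)
  intro w hw
  induction hw with
  | refl => exact hu
  | @tail b c _ hbc ih =>
    by_contra hc
    obtain ⟨e, he, heF⟩ := hbc
    refine heF (Finset.mem_coe.mpr ?_)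
    have heA : e ∈ A := (hA e).mpr he.1
    rcases he.2 with rfl | rfl
    · exact Finset.mem_union_left _ (Finset.mem_filter.mpr ⟨heA, ih, hc⟩)
    · exact Finset.mem_union_right _ (Finset.mem_filter.mpr ⟨heA, by simpa using ⟨hc, ih⟩⟩)

/-- Each of the `|X| |Xᶜ|` pairs across the cut carries an arc, and `ab ≥ a + b - 1` for positive
integers. -/
theorem card_sub_one_le_outDegree_add {A : Finset (V × V)}
    (hA : ∀ u v, u ≠ v → (u, v) ∈ A ∨ (v, u) ∈ A) {X : Finset V} (hX : X.Nonempty)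
    (hXu : X ≠ Finset.univ) : Fintype.card V - 1 ≤ outDegree A X + outDegree A Xᶜ := by
  have hsub : X ×ˢ Xᶜ ⊆ (A.filter fun a => a.1 ∈ X ∧ a.2 ∉ X) ∪
      (A.filter fun a => a.1 ∈ Xᶜ ∧ a.2 ∉ Xᶜ).image Prod.swap := by
    rintro ⟨u, v⟩ h
    obtain ⟨hu, hv⟩ := Finset.mem_product.mp h
    rw [Finset.mem_compl] at hv
    simp only at hu hv
    rcases hA u v (fun h => hv (h ▸ hu)) with h | h
    · exact Finset.mem_union_left _ (Finset.mem_filter.mpr ⟨h, hu, hv⟩)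
    · exact Finset.mem_union_right _
        (Finset.mem_image.mpr ⟨(v, u), Finset.mem_filter.mpr ⟨h, by simp [hu, hv]⟩, rfl⟩)
  have h1 := (Finset.card_le_card hsub).trans
    ((Finset.card_union_le _ _).trans (Nat.add_le_add_left Finset.card_image_le _))
  rw [Finset.card_product] at h1
  have h2 : 1 ≤ X.card := hX.card_pos
  have h3 : 1 ≤ Xᶜ.card := Finset.card_pos.mpr <| by
    rw [Finset.nonempty_iff_ne_empty]
    simpa [Finset.compl_eq_empty_iff] using hXu
  have h4 := Finset.card_add_card_compl X
  refine le_trans ?_ h1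
  rw [← h4]
  obtain ⟨a, ha⟩ := Nat.exists_eq_add_of_le h2
  obtain ⟨b, hb⟩ := Nat.exists_eq_add_of_le h3
  rw [ha, hb]
  have : (1 + a) * (1 + b) = 1 + a + b + a * b := by ring
  omega

theorem outDegree_add_le_erase (A : Finset (V × V)) (e : V × V) (X : Finset V) :
    outDegree A X + outDegree A Xᶜ ≤ outDegree (A.erase e) X + outDegree (A.erase e) Xᶜ + 1 := by
  by_cases he : e ∈ A
  · simp only [outDegree_eq_sum, ← Finset.sum_add_distrib]
    rw [← Finset.sum_erase_add _ _ he]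
    refine Nat.add_le_add_left ?_ _
    by_cases h1 : e.1 ∈ X <;> by_cases h2 : e.2 ∈ X <;> simp [h1, h2]
  · rw [Finset.erase_eq_of_notMem he]
    omega

end Digraph

/-! ### Inversions as edge vectors modulo 2. -/

namespace Digraph

variable {V : Type*}

/-- The digraph obtained from `D` by reversing the arcs on the edges where `f` is nonzero. -/
def reverseEdges (D : Digraph V) (f : Sym2 V → ZMod 2) : Digraph V where
  Adj u v := (f s(u, v) = 0 ∧ D.Adj u v) ∨ (f s(u, v) ≠ 0 ∧ D.Adj v u)

theorem reverseEdges_zero (D : Digraph V) : D.reverseEdges 0 = D := by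
  ext u v
  simp [reverseEdges]

theorem reverseEdges_reverseEdges (D : Digraph V) (f f' : Sym2 V → ZMod 2) :
    (D.reverseEdges f).reverseEdges f' = D.reverseEdges (f + f') := by
  have key : ∀ a b : ZMod 2, (a + b = 0 ↔ (a = 0 ↔ b = 0)) := by decide
  ext u v
  simp only [reverseEdges, Pi.add_apply, ne_eq, key, Sym2.eq_swap (a := v) (b := u)]
  tauto

theorem invert_eq_reverseEdges [DecidableEq V] (D : Digraph V) (X : Finset V) :
    D.invert X = D.reverseEdges (cliqueVector X) := by
  ext u v
  simp only [invert, reverseEdges, cliqueVector_mk]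
  by_cases huv : u = v
  · subst huv
    simp
    tauto
  · by_cases hX : u ∈ X ∧ v ∈ X
    · simp [huv, hX.1, hX.2]
    · simp only [ne_eq, huv, not_false_eq_true, true_and, if_neg hX]
      tauto

theorem invertAll_eq_reverseEdges [DecidableEq V] (D : Digraph V) (𝒳 : Finset (Finset V)) :
    D.invertAll 𝒳 = D.reverseEdges (∑ X ∈ 𝒳, cliqueVector X) := by
  rw [invertAll, Finset.sum_eq_multiset_sum]
  induction 𝒳.val using Multiset.induction_on generalizing D with
  | empty => simp [reverseEdges_zero]
  | cons X s ih =>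
    rw [Multiset.foldl_cons, ih, invert_eq_reverseEdges, reverseEdges_reverseEdges,
      Multiset.map_cons, Multiset.sum_cons]

/-- If the edge `s(u₀, v₀)` may be oriented either way without affecting the arcs in `A`, then a
suitable orientation is reachable by inverting `p`-sets. -/
theorem isInvertible_of_le_outDegree_add [Fintype V] [DecidableEq V] (D : Digraph V) {k p : ℕ}
    (hp : 2 ≤ p) (hp_even : Even p) (hcard : p + 2 ≤ Fintype.card V) {A : Finset (V × V)}
    (hAD : ∀ a ∈ A, D.Adj a.1 a.2)
    (hA : ∀ X : Finset V, X.Nonempty → X ≠ Finset.univ → 2 * k ≤ outDegree A X + outDegree A Xᶜ)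
    {u₀ v₀ : V} (huv : u₀ ≠ v₀) (hfree : ∀ a ∈ A, s(a.1, a.2) = s(u₀, v₀) → D.Adj a.2 a.1) :
    D.IsInvertible k p := by
  classical
  obtain ⟨R, hRA, hswap, hk⟩ := exists_reversal_forall_le_outDegree hA
  set f₀ : Sym2 V → ZMod 2 := fun e => if ∃ a ∈ R, s(a.1, a.2) = e then 1 else 0 with hf₀
  -- `c` is the parity of the set of reversed edges; adding it at the free pair makes the total
  -- even.
  set c := ∑ e, f₀ e
  set f : Sym2 V → ZMod 2 := f₀ + Pi.single s(u₀, v₀) c with hf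
  have hdiag : ∀ e, e.IsDiag → f e = 0 := by
    intro e he
    have h1 : ¬∃ a ∈ R, s(a.1, a.2) = e := by
      rintro ⟨⟨u, v⟩, ha, rfl⟩
      rw [Sym2.mk_isDiag_iff] at he
      simp only at he
      subst he
      exact hswap _ ha (hRA ha)
    have h2 : e ≠ s(u₀, v₀) := by
      rintro rfl
      exact huv (by simpa using he)
    simp only [hf, hf₀, Pi.add_apply, if_neg h1, Pi.single_eq_of_ne h2, add_zero]
  have hsum : ∑ e, f e = 0 := by
    simp only [hf, Pi.add_apply, Finset.sum_add_distrib]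
    rw [Finset.sum_pi_single', if_pos (Finset.mem_univ _)]
    exact CharTwo.add_self_eq_zero _
  obtain ⟨𝒳, h𝒳, hf𝒳⟩ := exists_sum_cliqueVector_of_mem_cliqueSpan
    (mem_cliqueSpan_of_sum_eq_zero hp hp_even hcard hdiag hsum)
  refine ⟨𝒳, h𝒳, ?_⟩
  rw [invertAll_eq_reverseEdges, ← hf𝒳]
  refine isKArcStrong_of_forall_le_outDegree _ (fun a ha => ?_) hk
  rcases Finset.mem_union.mp ha with ha | ha
  · obtain ⟨haA, haR⟩ := Finset.mem_sdiff.mp ha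
    -- An arc of `A` on the free pair has its reverse in `D` too, so both directions are present
    -- whether or not the pair is toggled.
    by_cases h0 : s(a.1, a.2) = s(u₀, v₀)
    · have h1 := hAD a haA
      have h2 := hfree a haA h0
      simp only [reverseEdges]
      tauto
    · have h1 : ¬∃ b ∈ R, s(b.1, b.2) = s(a.1, a.2) := by
        rintro ⟨b, hb, hba⟩
        rcases Sym2.eq_iff.mp hba with ⟨e1, e2⟩ | ⟨e1, e2⟩
        · exact haR (Prod.ext e1 e2 ▸ hb)
        · exact hswap b hb ((Prod.ext e2 e1 : b.swap = a) ▸ haA)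
      refine Or.inl ⟨?_, hAD a haA⟩
      simp only [hf, hf₀, Pi.add_apply, if_neg h1, Pi.single_eq_of_ne h0, add_zero]
  · obtain ⟨b, hb, rfl⟩ := Finset.mem_image.mp ha
    have hbA := hRA hb
    by_cases h0 : s(b.1, b.2) = s(u₀, v₀)
    · have h1 := hAD b hbA
      have h2 := hfree b hbA h0
      simp only [reverseEdges, Prod.fst_swap, Prod.snd_swap]
      tauto
    · have h1 : ∃ a ∈ R, s(a.1, a.2) = s(b.1, b.2) := ⟨b, hb, rfl⟩
      refine Or.inr ⟨?_, hAD b hbA⟩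
      simp only [Prod.fst_swap, Prod.snd_swap]
      rw [Sym2.eq_swap]
      simp only [hf, hf₀, Pi.add_apply, if_pos h1, Pi.single_eq_of_ne h0]
      decide

end Digraph

theorem mainTheorem2 {V : Type*} [Fintype V] (D : Digraph V) (k p : ℕ) (hk : 1 ≤ k) (hp : 2 ≤ p)
    (hp_even : Even p) (hcard : max (p + 2) (2 * k + 2) ≤ Fintype.card V)
    (hD : D.IsKEdgeConnected (2 * k)) :
    D.IsInvertible k p := by
  classical
  have hcard₁ : p + 2 ≤ Fintype.card V := (le_max_left _ _).trans hcard
  have hcard₂ : 2 * k + 2 ≤ Fintype.card V := (le_max_right _ _).trans hcard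
  set A : Finset (V × V) := Finset.univ.filter fun a => D.Adj a.1 a.2 with hAdef
  have hA : ∀ a, a ∈ A ↔ D.Adj a.1 a.2 := by simp [hAdef]
  -- The equivalence says that the pair is either nonadjacent or a digon, hence unaffected by
  -- toggling.
  by_cases htour : ∃ u v, u ≠ v ∧ (D.Adj u v ↔ D.Adj v u)
  · obtain ⟨u, v, huv, hiff⟩ := htour
    refine D.isInvertible_of_le_outDegree_add hp hp_even hcard₁ (A := A) (fun a ha => (hA a).mp ha)
      (fun X hX hXu => hD.le_outDegree_add hA hX hXu) huv ?_
    rintro ⟨a, b⟩ ha hab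
    have hadj := (hA _).mp ha
    rcases Sym2.eq_iff.mp hab with ⟨rfl, rfl⟩ | ⟨rfl, rfl⟩
    · exact hiff.mp hadj
    · exact hiff.mpr hadj
  · push Not at htour
    have htotal : ∀ u v, u ≠ v → (u, v) ∈ A ∨ (v, u) ∈ A := by
      intro u v huv
      rw [hA, hA]
      have := htour u v huv
      tauto
    obtain ⟨u, v, huv, hadj⟩ : ∃ u v, u ≠ v ∧ D.Adj u v := by
      obtain ⟨u, v, huv⟩ := Fintype.exists_pair_of_one_lt_card (α := V) (by omega)
      rcases htotal u v huv with h | h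
      · exact ⟨u, v, huv, (hA _).mp h⟩
      · exact ⟨v, u, huv.symm, (hA _).mp h⟩
    -- Cuts of the tournament have at least `n - 1 ≥ 2k + 1` arcs, so `2k` remain after the erasure
    -- and the pair `uv` becomes free.
    refine D.isInvertible_of_le_outDegree_add hp hp_even hcard₁ (A := A.erase (u, v))
      (fun a ha => (hA a).mp (Finset.mem_of_mem_erase ha)) (fun X hX hXu => ?_) huv ?_
    · have h1 := Digraph.card_sub_one_le_outDegree_add htotal hX hXu
      have h2 := Digraph.outDegree_add_le_erase A (u, v) X
      omega
    · rintro ⟨a, b⟩ ha hab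
      obtain ⟨hne, haA⟩ := Finset.mem_erase.mp ha
      rcases Sym2.eq_iff.mp hab with ⟨rfl, rfl⟩ | ⟨rfl, rfl⟩
      · exact absurd rfl hne
      · exact hadj
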